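/- Let $X$ be a non-empty finite set with $n$ elements, and let $S:X\times X\to X\times X$, $S(x,y)=(g_x(y),f_y(x))$, be a non-degenerate symmetric set-theoretical solution of the quantum Yang–Baxter equation. That is, all the maps $g_x,f_x:X\to X$ are bijective, $S\circ S=\mathrm{Id}$, and $S^{12}S^{23}S^{12}=S^{23}S^{12}S^{23}$ on $X^3$. A pair $(x,y)\in X^2$ is called frozen if $S(x,y)=(x,y)$. Assume Property $(\mathcal C)$: for every frozen pair $(x,y)$ one has $g_x\circ g_y=\mathrm{Id}_X$ and $f_y\circ f_x=\mathrm{Id}_X$. Let $M(X,S)$ and $G(X,S)$ be the monoid and the group with presentation $\langle X\mid xy=g_x(y)f_y(x)\ ;\ x,y\in X,\ S(x,y)\neq(x,y)\rangle$. A Garside element of $M(X,S)$ is an element whose left divisors and right divisors are the same elements and whose divisors generate $M(X,S)$. The monoid $M(X,S)$ has a unique Garside element $\Delta$ that both left-divides and right-divides every Garside element; it is called the Garside element of $M(X,S)$. Let $V$ be the real vector space with basis $X$, and for $x\in X$ put $\phi_x=f_x^{-1}$. Let $\psi_x\in GL(V)$ be the linear map with $\psi_x(x)=-\phi_x(x)$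 and $\psi_x(y)=\phi_x(y)$ for $y\in X\setminus\{x\}$. The assignment $x\mapsto\psi_x$ extends to a morphism $\psi:G(X,S)\to GL(V)$; let $W(X,S)=\psi(G(X,S))$ be its image, and set $\mathbf X=\{\psi_x\mid x\in X\}$. Composing $\psi$ with the canonical morphism $M(X,S)\to G(X,S)$, we also write $\psi(a)$ for $a\in M(X,S)$. The length on $\mathbf X$ of $w\in W(X,S)$ is the least length of a word on $\mathbf X$ that represents $w$. Then: (1) The group $W(X,S)$ contains a unique element $w_0$ of maximal length on $\mathbf X$. This element is $\psi(\Delta)$, and its length on $\mathbf X$ is $n$. (2) The order of $w_0$ is two, and conjugation by $w_0$ permutes the elements of $\mathbf X$. -/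

import Mathlib

noncomputable section

/-- A non-degenerate symmetric (that is, involutive and braided) set-theoretical solution
`(X, S)` of the quantum Yang-Baxter equation. We write `S (x, y) = (g_x y, f_y x)`. -/
structure SymmSolution (X : Type*) where
  /-- the map `S : X × X → X × X` -/
  S : X × X → X × X
  /-- every `g_x : y ↦ (S (x, y)).1` is bijective -/
  bijective_g : ∀ x, Function.Bijective fun y => (S (x, y)).1
  /-- every `f_y : x ↦ (S (x, y)).2` is bijective -/
  bijective_f : ∀ y, Function.Bijective fun x => (S (x, y)).2
  /-- `S ∘ S = id` -/
  involutive : ∀ p, S (S p) = p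
  /-- `S¹² S²³ S¹² = S²³ S¹² S²³` as maps of `X × X × X` -/
  braided :
    let S12 : X × X × X → X × X × X := fun t =>
      ((S (t.1, t.2.1)).1, (S (t.1, t.2.1)).2, t.2.2)
    let S23 : X × X × X → X × X × X := fun t => (t.1, S t.2)
    S12 ∘ S23 ∘ S12 = S23 ∘ S12 ∘ S23

namespace SymmSolution

variable {X : Type*} (s : SymmSolution X)

/-- The map `g_x : X → X`. -/
def g (x y : X) : X := (s.S (x, y)).1

/-- The map `f_y : X → X`; note the order of the arguments, `s.f y x = f_y(x)`. -/
def f (y x : X) : X := (s.S (x, y)).2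

/-- `(x, y)` is a frozen pair if `S (x, y) = (x, y)`. -/
def IsFrozen (x y : X) : Prop := s.S (x, y) = (x, y)

/-- Property (C): `g_x ∘ g_y = id` and `f_y ∘ f_x = id` for every frozen pair `(x, y)`. -/
def PropertyC : Prop :=
  ∀ x y, s.IsFrozen x y → s.g x ∘ s.g y = id ∧ s.f y ∘ s.f x = id

/-- The defining relations `x y = g_x(y) f_y(x)`, for `S (x, y) ≠ (x, y)`, as pairs of words. -/
def monoidRel (u v : FreeMonoid X) : Prop :=
  ∃ x y, ¬ s.IsFrozen x y ∧ u = FreeMonoid.of x * FreeMonoid.of y ∧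
    v = FreeMonoid.of (s.g x y) * FreeMonoid.of (s.f y x)

/-- The structure monoid `M(X, S)`, given by its monoid presentation. -/
abbrev StructureMonoid : Type _ := PresentedMonoid s.monoidRel

/-- The defining relators of the structure group. -/
def groupRels : Set (FreeGroup X) :=
  {r | ∃ x y, ¬ s.IsFrozen x y ∧
    r = FreeGroup.of x * FreeGroup.of y *
      (FreeGroup.of (s.g x y) * FreeGroup.of (s.f y x))⁻¹}

/-- The structure group `G(X, S)`, given by the group presentation on the same generators and
relations. -/
abbrev StructureGroup : Type _ := PresentedGroup s.groupRels

/-- The canonical morphism `M(X, S) → G(X, S)`, the identity on the generators. -/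
def toGroup : s.StructureMonoid →* s.StructureGroup :=
  PresentedMonoid.lift (fun x => PresentedGroup.of x) (by
    rintro u v ⟨x, y, h, rfl, rfl⟩
    simp only [map_mul, FreeMonoid.lift_eval_of]
    refine mul_inv_eq_one.mp ?_
    exact PresentedGroup.one_of_mem (rels := s.groupRels) ⟨x, y, h, rfl⟩)

/-- The permutation `φ_x = f_x⁻¹` of `X`. -/
def phi (x : X) : Equiv.Perm X := (Equiv.ofBijective (s.f x) (s.bijective_f x)).symm

lemma f_phi (x y : X) : s.f x (s.phi x y) = y :=
  (Equiv.ofBijective (s.f x) (s.bijective_f x)).apply_symm_apply y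

lemma phi_f (x y : X) : s.phi x (s.f x y) = y :=
  (Equiv.ofBijective (s.f x) (s.bijective_f x)).symm_apply_apply y

open Classical in
/-- The linear map `ψ_x` of the real vector space `V` with basis `X`: `ψ_x(y) = φ_x(y)` for
`y ≠ x`, and `ψ_x(x) = -φ_x(x)`. -/
def psiLin (x : X) : (X →₀ ℝ) →ₗ[ℝ] (X →₀ ℝ) :=
  Finsupp.linearCombination ℝ fun y =>
    if y = x then -Finsupp.single (s.phi x y) 1 else Finsupp.single (s.phi x y) 1

open Classical in
/-- The inverse of `ψ_x`. -/
def psiLinInv (x : X) : (X →₀ ℝ) →ₗ[ℝ] (X →₀ ℝ) :=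
  Finsupp.linearCombination ℝ fun y =>
    if s.f x y = x then -Finsupp.single (s.f x y) 1 else Finsupp.single (s.f x y) 1

open Classical in
lemma psiLin_single (x y : X) : s.psiLin x (Finsupp.single y 1) =
    if y = x then -Finsupp.single (s.phi x y) 1 else Finsupp.single (s.phi x y) 1 := by
  simp [psiLin]

open Classical in
lemma psiLinInv_single (x y : X) : s.psiLinInv x (Finsupp.single y 1) =
    if s.f x y = x then -Finsupp.single (s.f x y) 1 else Finsupp.single (s.f x y) 1 := by
  simp [psiLinInv]

/-- `ψ_x` as an element of `GL(V)`. -/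
def psiGen (x : X) : LinearMap.GeneralLinearGroup ℝ (X →₀ ℝ) where
  val := s.psiLin x
  inv := s.psiLinInv x
  val_inv := by
    ext1 y
    ext1
    simp only [LinearMap.comp_apply, Finsupp.lsingle_apply, Module.End.mul_apply,
      Module.End.one_apply, psiLinInv_single]
    split_ifs with h
    · rw [map_neg, psiLin_single, if_pos h, phi_f, neg_neg]
    · rw [psiLin_single, if_neg h, phi_f]
  inv_val := by
    ext1 y
    ext1
    simp only [LinearMap.comp_apply, Finsupp.lsingle_apply, Module.End.mul_apply,
      Module.End.one_apply, psiLin_single]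
    split_ifs with h <;> simp [psiLinInv_single, f_phi, h]

lemma phi_phi (x y z : X) :
    s.phi x (s.phi y z) = s.phi (s.g x y) (s.phi (s.f y x) z) := by
  obtain ⟨t, rfl⟩ : ∃ t, s.f y (s.f x t) = z :=
    ⟨s.phi x (s.phi y z), by rw [f_phi, f_phi]⟩
  have h : s.f y (s.f x t) = s.f (s.f y x) (s.f (s.g x y) t) :=
    congrArg (fun p => p.2.2) (congrFun s.braided (t, x, y))
  rw [phi_f, phi_f, h, phi_f, phi_f]

lemma f_f_g (x y : X) : s.f (s.f y x) (s.g x y) = y :=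
  congrArg Prod.snd (s.involutive (x, y))

open Classical in
lemma psi_psi_single (x y z : X) :
    s.psiLin x (s.psiLin y (Finsupp.single z 1)) =
      ((if z = y then -1 else 1 : ℝ) * (if z = s.f y x then -1 else 1 : ℝ)) •
        Finsupp.single (s.phi x (s.phi y z)) 1 := by
  have h : s.phi y z = x ↔ z = s.f y x :=
    ⟨fun h => by rw [← h, f_phi], fun h => by rw [h, phi_f]⟩
  rw [psiLin_single]
  by_cases h1 : z = y
  · rw [if_pos h1, if_pos h1, map_neg, psiLin_single]
    by_cases h2 : z = s.f y x
    · rw [if_pos h2, if_pos (h.mpr h2)]; simp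
    · rw [if_neg h2, if_neg (mt h.mp h2)]; simp
  · rw [if_neg h1, if_neg h1, psiLin_single]
    by_cases h2 : z = s.f y x
    · rw [if_pos h2, if_pos (h.mpr h2)]; simp
    · rw [if_neg h2, if_neg (mt h.mp h2)]; simp

/-- The maps `ψ_x` satisfy the defining relations of the structure group. -/
lemma psiGen_mul (x y : X) :
    s.psiGen x * s.psiGen y = s.psiGen (s.g x y) * s.psiGen (s.f y x) := by
  apply Units.ext
  show s.psiLin x * s.psiLin y = s.psiLin (s.g x y) * s.psiLin (s.f y x)
  ext1 z
  ext1
  simp only [LinearMap.comp_apply, Finsupp.lsingle_apply, Module.End.mul_apply,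
    psi_psi_single]
  rw [f_f_g, ← phi_phi, mul_comm]

/-- The representation `ψ : G(X, S) → GL(V)`. -/
def psi : s.StructureGroup →* LinearMap.GeneralLinearGroup ℝ (X →₀ ℝ) :=
  PresentedGroup.toGroup (f := s.psiGen) (by
    rintro r ⟨x, y, -, rfl⟩
    simp only [map_mul, map_inv, FreeGroup.lift_apply_of]
    rw [s.psiGen_mul x y, mul_inv_cancel])

/-- The group `W(X, S) = ψ(G(X, S))`. -/
abbrev W : Subgroup (LinearMap.GeneralLinearGroup ℝ (X →₀ ℝ)) := s.psi.range

/-- The surjective morphism `ψ : M(X, S) → W(X, S)`, the composite of `M(X, S) → G(X, S)` and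
`ψ : G(X, S) → W(X, S)`. -/
def psiW : s.StructureMonoid →* s.W := s.psi.rangeRestrict.comp s.toGroup

/-- The generating set `{ψ_x | x ∈ X}` of `W(X, S)`. -/
def gens : Set s.W := Set.range fun x => s.psiW (PresentedMonoid.of s.monoidRel x)

end SymmSolution

/-- A Garside element of a monoid: it is balanced (its left and its right divisors are the same
elements), and its divisors generate the monoid. Here `a ∣ d` is left divisibility, `d = a * c` for
some `c`, and `RightDvd a d` is right divisibility, `d = c * a` for some `c`. -/
def IsGarsideElement {M : Type*} [Monoid M] (d : M) : Prop :=
  (∀ a, a ∣ d ↔ RightDvd a d) ∧ Submonoid.closure {a : M | a ∣ d} = ⊤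

/-- *The* Garside element: the least Garside element, for left and for right divisibility. -/
def IsTheGarsideElement {M : Type*} [Monoid M] (d : M) : Prop :=
  IsGarsideElement d ∧ ∀ e, IsGarsideElement e → d ∣ e ∧ RightDvd d e

/-- The length of `w` with respect to `A`: the least length of a word in the elements of `A` that
represents `w` (it is `⊤` if there is no such word). -/
def wordLength {H : Type*} [Monoid H] (A : Set H) (w : H) : ℕ∞ :=
  ⨅ l : {l : List H // (∀ a ∈ l, a ∈ A) ∧ l.prod = w}, (l.1.length : ℕ∞)

end

/-! The proof rests on a bijective cocycle from `M(X, S)` to `ℕ^X`. Let `M(X, S)` act on `X × ℕ`,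
the counter recording how often a letter `x` meets the point `x`. This gives multiplicities with
`mult (a * b) y = mult b y + mult a (perm b y)`. They determine `a`, and every vector occurs
(`mult_injective`, `mult_surjective`). Right divisibility becomes the pointwise order
(`rightDvd_iff`), so `Δ` is the element with all multiplicities 1.

The matrix `ψ(a)` is the permutation `perm a` with signs `(-1) ^ mult a y`. Property (C) says
exactly what is needed for the element of multiplicity `2 e_z` to act trivially
(`psiW_phi_self_mul`). Hence `ψ(a)` depends only on the parities of the multiplicities
(`psiW_eq_iff`), `W(X, S)` is in bijection with `{0, 1}^X`, and length is the number of odd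
coordinates (`wordLength_psiW`). The all-odd vector, that of `Δ`, is the unique maximum; the claims
on order and conjugation are parity computations. -/

noncomputable section

namespace SymmSolution

/-! ### The multiplicity cocycle on the structure monoid. -/

variable {X : Type*} (s : SymmSolution X)

/-- The generator of `M(X, S)` given by `x`. -/
abbrev gen (x : X) : s.StructureMonoid := PresentedMonoid.of s.monoidRel x

/-- The morphism `M(X, S) → Sym(X)` extending `x ↦ φ_x`. -/
def perm : s.StructureMonoid →* Equiv.Perm X :=
  PresentedMonoid.lift s.phi (by
    rintro u v ⟨x, y, -, rfl, rfl⟩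
    ext z
    simpa using s.phi_phi x y z)

@[simp] lemma perm_gen (x : X) : s.perm (s.gen x) = s.phi x := rfl

lemma phi_eq_iff {x y z : X} : s.phi y z = x ↔ z = s.f y x :=
  ⟨fun h => by rw [← h, f_phi], fun h => by rw [h, phi_f]⟩

open Classical in
/-- The self-map of `X × ℕ` sending `(y, k)` to `(φ_x(y), k + 1)` if `y = x` and to `(φ_x(y), k)`
otherwise. -/
def actGen (x : X) : Function.End (X × ℕ) :=
  fun p => (s.phi x p.1, p.2 + if p.1 = x then 1 else 0)

open Classical in
/-- The action of `M(X, S)` on `X × ℕ` extending `actGen`. -/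
def act : s.StructureMonoid →* Function.End (X × ℕ) :=
  PresentedMonoid.lift s.actGen (by
    rintro u v ⟨x, y, -, rfl, rfl⟩
    simp only [map_mul, FreeMonoid.lift_eval_of]
    funext ⟨z, k⟩
    change s.actGen x (s.actGen y (z, k)) = s.actGen (s.g x y) (s.actGen (s.f y x) (z, k))
    have h1 : s.phi y z = x ↔ z = s.f y x := s.phi_eq_iff
    have h2 : s.phi (s.f y x) z = s.g x y ↔ z = y := by rw [phi_eq_iff, f_f_g]
    refine Prod.ext (s.phi_phi x y z) ?_
    change k + (if z = y then 1 else 0) + (if s.phi y z = x then 1 else 0) =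
      k + (if z = s.f y x then 1 else 0) + (if s.phi (s.f y x) z = s.g x y then 1 else 0)
    rw [if_congr h1 rfl rfl, if_congr h2 rfl rfl, Nat.add_right_comm])

/-- The multiplicities `a ↦ v_a ∈ ℕ^X`, a cocycle on `M(X, S)` extending `x ↦ e_x`. -/
def mult (a : s.StructureMonoid) (y : X) : ℕ := (s.act a (y, 0)).2

variable {s}

@[elab_as_elim]
lemma mul_induction {P : s.StructureMonoid → Prop} (one : P 1)
    (mul : ∀ x b, P b → P (s.gen x * b)) (a : s.StructureMonoid) : P a := by
  have h : a ∈ Submonoid.closure (Set.range (PresentedMonoid.of s.monoidRel)) := by simp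
  induction h using Submonoid.closure_induction_left with
  | one => exact one
  | mul_left x hx y _ ih => obtain ⟨x, rfl⟩ := hx; exact mul x y ih

lemma eq_one_or_eq_gen_mul (a : s.StructureMonoid) : a = 1 ∨ ∃ x b, a = s.gen x * b := by
  induction a using mul_induction with
  | one => exact .inl rfl
  | mul x b _ => exact .inr ⟨x, b, rfl⟩

open Classical in
lemma act_gen (x : X) (p : X × ℕ) :
    s.act (s.gen x) p = (s.phi x p.1, p.2 + if p.1 = x then 1 else 0) := rfl

lemma act_apply (a : s.StructureMonoid) (y : X) (k : ℕ) :
    s.act a (y, k) = (s.perm a y, k + s.mult a y) := by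
  induction a using mul_induction generalizing y k with
  | one => simp [mult, Function.End.one_def]
  | mul x b ih =>
    have h (k : ℕ) : s.act (s.gen x * b) (y, k) = s.act (s.gen x) (s.act b (y, k)) := by
      rw [map_mul]; rfl
    have hm : s.mult (s.gen x * b) y = (s.act (s.gen x) (s.act b (y, 0))).2 := by rw [← h]; rfl
    rw [hm, h, ih, ih, act_gen, act_gen]
    simp only [map_mul, perm_gen, Equiv.Perm.mul_apply, Nat.zero_add, Nat.add_assoc]

@[simp] lemma mult_one (y : X) : s.mult 1 y = 0 := by simp [mult, Function.End.one_def]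

lemma mult_mul (a b : s.StructureMonoid) (y : X) :
    s.mult (a * b) y = s.mult b y + s.mult a (s.perm b y) := by
  have h : s.act (a * b) (y, 0) = s.act a (s.act b (y, 0)) := by rw [map_mul]; rfl
  rw [mult, h, act_apply, act_apply, Nat.zero_add]

open Classical in
lemma mult_gen (x y : X) : s.mult (s.gen x) y = if y = x then 1 else 0 := by
  simp [mult, act_gen]

open Classical in
-- A letter `x` prepended to `b` raises the multiplicity at `(perm b)⁻¹ x`; writing `x` as `perm b
-- z` makes the raised coordinate `z` explicit.
lemma mult_gen_mul (b : s.StructureMonoid) (z y : X) :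
    s.mult (s.gen (s.perm b z) * b) y = s.mult b y + if y = z then 1 else 0 := by
  rw [mult_mul, mult_gen]
  simp

lemma g_phi (y z : X) : s.g (s.phi z y) z = s.phi y z := by
  have h := s.f_f_g (s.phi z y) z
  rw [f_phi] at h
  rw [← h, phi_f, h]

/-- The defining relations in a form symmetric in `y` and `z`. A frozen pair forces `y = z`, so no
exception is needed. -/
lemma gen_phi_mul_gen (y z : X) :
    s.gen (s.phi z y) * s.gen z = s.gen (s.phi y z) * s.gen y := by
  by_cases h : s.IsFrozen (s.phi z y) z
  · have h1 : s.g (s.phi z y) z = s.phi z y := congrArg Prod.fst h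
    have h2 : s.f z (s.phi z y) = z := congrArg Prod.snd h
    rw [f_phi] at h2
    rw [h2]
  · refine PresentedMonoid.mk_eq_mk_of_rel ⟨_, _, h, rfl, ?_⟩
    rw [g_phi, f_phi]

/-- The relation between generators that a common multiple of two words yields. -/
lemma gen_mul_gen_mul (c : s.StructureMonoid) (u w : X) :
    s.gen (s.perm (s.gen (s.perm c w) * c) u) * (s.gen (s.perm c w) * c) =
      s.gen (s.perm (s.gen (s.perm c u) * c) w) * (s.gen (s.perm c u) * c) := by
  simp only [map_mul, perm_gen, Equiv.Perm.mul_apply, ← mul_assoc]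
  rw [gen_phi_mul_gen]

lemma isFrozen_phi_self (z : X) : s.IsFrozen (s.phi z z) z := by
  have h1 : s.g (s.phi z z) z = s.phi z z := g_phi z z
  have h2 : s.f z (s.phi z z) = z := s.f_phi z z
  exact Prod.ext h1 h2

/-! ### Bijectivity of the cocycle, and divisibility. -/

section Finite

variable [Fintype X]

/-- The length of an element of `M(X, S)`. -/
def degree (a : s.StructureMonoid) : ℕ := ∑ y, s.mult a y

@[simp] lemma degree_one : degree (1 : s.StructureMonoid) = 0 := by simp [degree]

lemma degree_mul (a b : s.StructureMonoid) : degree (a * b) = degree a + degree b := by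
  simp only [degree, mult_mul, Finset.sum_add_distrib]
  rw [Equiv.sum_comp (s.perm b) (s.mult a), Nat.add_comm]

@[simp] lemma degree_gen (x : X) : degree (s.gen x) = 1 := by
  classical
  simp [degree, mult_gen]

lemma eq_one_of_degree_eq_zero {a : s.StructureMonoid} (h : degree a = 0) : a = 1 := by
  obtain rfl | ⟨x, b, rfl⟩ := eq_one_or_eq_gen_mul a
  · rfl
  · rw [degree_mul, degree_gen] at h; omega

variable (s) in
lemma mult_surjective (v : X → ℕ) : ∃ a, s.mult a = v := by
  classical
  induction hn : ∑ y, v y generalizing v with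
  | zero =>
    refine ⟨1, funext fun y => ?_⟩
    rw [mult_one]
    exact ((Finset.sum_eq_zero_iff.mp hn) y (Finset.mem_univ y)).symm
  | succ n ih =>
    obtain ⟨z, hz⟩ : ∃ z, v z ≠ 0 := by
      by_contra! h
      simp [h] at hn
    have hv (y : X) : v y = (v - Pi.single z 1 : X → ℕ) y + if y = z then 1 else 0 := by
      by_cases h : y = z
      · subst h; simp; omega
      · simp [h]
    obtain ⟨b, hb⟩ := ih (v - Pi.single z 1) (by
      simp_rw [hv, Finset.sum_add_distrib] at hn
      simpa using hn)
    refine ⟨s.gen (s.perm b z) * b, ?_⟩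
    funext y
    rw [hv, mult_gen_mul, hb]

lemma mult_injective : Function.Injective s.mult := by
  classical
  intro a b hab
  induction hn : degree a generalizing a b with
  | zero =>
    have hb : degree b = 0 := by rw [← hn, degree, degree, hab]
    rw [eq_one_of_degree_eq_zero hn, eq_one_of_degree_eq_zero hb]
  | succ n ih =>
    have hb : degree b = n + 1 := by rw [← hn, degree, degree, hab]
    obtain rfl | ⟨x, a, rfl⟩ := eq_one_or_eq_gen_mul a
    · simp at hn
    obtain rfl | ⟨y, b, rfl⟩ := eq_one_or_eq_gen_mul b
    · simp at hb
    rw [degree_mul, degree_gen] at hn hb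
    have hn : degree a = n := by omega
    have hb : degree b = n := by omega
    obtain ⟨u, rfl⟩ := (s.perm a).surjective x
    obtain ⟨w, rfl⟩ := (s.perm b).surjective y
    have key (t : X) := congrFun hab t
    simp only [mult_gen_mul] at key
    by_cases huw : u = w
    · subst huw
      rw [ih (funext fun t => by simpa using key t) hn]
    · obtain ⟨c, hc⟩ := s.mult_surjective fun t => s.mult a t - if t = w then 1 else 0
      have hca : a = s.gen (s.perm c w) * c := by
        refine ih (funext fun t => ?_) hn
        rw [mult_gen_mul, hc]
        have := key t
        by_cases h : t = w
        · subst h; simp [Ne.symm huw] at this ⊢; omega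
        · simp [h]
      have hcb : b = s.gen (s.perm c u) * c := by
        refine ih (funext fun t => ?_) hb
        rw [mult_gen_mul, hc]
        have := key t
        by_cases h : t = w
        · subst h; simp [Ne.symm huw] at this ⊢; omega
        · simp [h] at this ⊢; omega
      rw [hca, hcb, gen_mul_gen_mul]

/-- The cocycle is additive along a right factor up to relabelling by `perm a`, so the cofactor is
the element whose multiplicities are the relabelled difference. -/
lemma rightDvd_iff {a b : s.StructureMonoid} : RightDvd a b ↔ ∀ y, s.mult a y ≤ s.mult b y := by
  constructor
  · rintro ⟨c, rfl⟩ y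
    rw [mult_mul]
    omega
  · intro h
    obtain ⟨c, hc⟩ := s.mult_surjective fun y =>
      s.mult b ((s.perm a).symm y) - s.mult a ((s.perm a).symm y)
    refine ⟨c, mult_injective (funext fun y => ?_)⟩
    rw [mult_mul, hc]
    simp [h y]

lemma mul_left_cancel' {a b c : s.StructureMonoid} (h : a * b = a * c) : b = c := by
  have hp : s.perm b = s.perm c := by
    have := congrArg s.perm h
    rwa [map_mul, map_mul, mul_right_inj] at this
  refine mult_injective (funext fun y => ?_)
  have := congrFun (congrArg s.mult h) y
  rw [mult_mul, mult_mul, hp] at this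
  omega

/-! ### Garside elements. -/

lemma dvd_iff_rightDvd_of_mult_eq_one {d : s.StructureMonoid} (hd : ∀ y, s.mult d y = 1)
    (a : s.StructureMonoid) : a ∣ d ↔ RightDvd a d := by
  have hsimple {a c : s.StructureMonoid} (h : d = a * c) : RightDvd a d := by
    refine rightDvd_iff.mpr fun y => ?_
    obtain ⟨z, rfl⟩ := (s.perm c).surjective y
    have := hd z
    rw [h, mult_mul] at this
    rw [hd]
    omega
  refine ⟨fun ⟨c, hc⟩ => hsimple hc, fun ha => ?_⟩
  classical
  -- The right divisors of `d` form a finite set, and `c ↦ F c` with `d = F c * c` maps it to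
  -- itself. Left cancellation makes this map injective, hence surjective, so every right divisor is
  -- also a left divisor.
  let D : Set s.StructureMonoid := {a | RightDvd a d}
  have hfin : Finite D := by
    refine Set.Finite.to_subtype (Set.Finite.of_finite_image (f := s.mult)
      (Set.Finite.subset (Set.finite_Icc 0 (fun _ : X => 1)) ?_) mult_injective.injOn)
    rintro _ ⟨a, ha, rfl⟩
    refine ⟨fun _ => Nat.zero_le _, fun y => ?_⟩
    exact (rightDvd_iff.mp ha y).trans (hd y).le
  choose F hF using fun c : D => (c.2 : RightDvd c.1 d)
  let F' : D → D := fun c => ⟨F c, hsimple (hF c)⟩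
  have hinj : Function.Injective F' := by
    intro c c' h
    have h : F c = F c' := congrArg Subtype.val h
    have h1 := hF c
    rw [hF c', ← h] at h1
    exact Subtype.ext (mul_left_cancel' h1).symm
  obtain ⟨c, hc⟩ := (Finite.injective_iff_surjective.mp hinj) ⟨a, ha⟩
  have hc : F c = a := congrArg Subtype.val hc
  exact ⟨c, by rw [← hc]; exact hF c⟩

lemma isGarsideElement_of_mult_eq_one {d : s.StructureMonoid} (hd : ∀ y, s.mult d y = 1) :
    IsGarsideElement d := by
  refine ⟨dvd_iff_rightDvd_of_mult_eq_one hd, ?_⟩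
  rw [eq_top_iff, ← PresentedMonoid.closure_range_of]
  refine Submonoid.closure_mono ?_
  rintro _ ⟨x, rfl⟩
  refine (dvd_iff_rightDvd_of_mult_eq_one hd _).mpr (rightDvd_iff.mpr fun y => ?_)
  classical
  rw [hd, mult_gen]
  split_ifs <;> simp

/-- Generators are atoms, having degree 1; so the elements other than `gen x` form a submonoid. -/
lemma gen_mem_of_closure_eq_top {D : Set s.StructureMonoid} (hD : Submonoid.closure D = ⊤)
    (x : X) : s.gen x ∈ D := by
  by_contra hx
  let N : Submonoid s.StructureMonoid :=
    { carrier := {a | a ≠ s.gen x}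
      one_mem' := fun h => by
        have := congrArg degree h
        simp at this
      mul_mem' := fun {a b} ha hb h => by
        have := congrArg degree h
        rw [degree_mul, degree_gen] at this
        rcases Nat.eq_zero_or_pos (degree a) with h0 | h0
        · rw [eq_one_of_degree_eq_zero h0, one_mul] at h
          exact hb h
        · rw [eq_one_of_degree_eq_zero (a := b) (by omega), mul_one] at h
          exact ha h }
  have hN : Submonoid.closure D ≤ N :=
    (Submonoid.closure_le (S := N)).mpr fun a ha h => hx (h ▸ ha)
  exact hN (hD ▸ Submonoid.mem_top (s.gen x)) rfl

lemma isTheGarsideElement_of_mult_eq_one {d : s.StructureMonoid} (hd : ∀ y, s.mult d y = 1) :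
    IsTheGarsideElement d := by
  refine ⟨isGarsideElement_of_mult_eq_one hd, fun e he => ?_⟩
  have h : RightDvd d e := rightDvd_iff.mpr fun y => by
    have := rightDvd_iff.mp ((he.1 _).mp (gen_mem_of_closure_eq_top he.2 y)) y
    rw [mult_gen, if_pos rfl] at this
    rwa [hd]
  exact ⟨(he.1 d).mpr h, h⟩

lemma eq_of_isTheGarsideElement {d e : s.StructureMonoid} (hd : IsTheGarsideElement d)
    (he : IsTheGarsideElement e) : d = e :=
  mult_injective (funext fun y => le_antisymm (rightDvd_iff.mp (hd.2 e he.1).2 y)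
    (rightDvd_iff.mp (he.2 d hd.1).2 y))

end Finite

/-! ### Signed permutations and the image in `W(X, S)`. -/

variable (s) in
lemma psiW_gen_val (x : X) : (s.psiW (s.gen x) : LinearMap.GeneralLinearGroup ℝ (X →₀ ℝ)) =
    s.psiGen x := by
  change s.psi (s.toGroup (s.gen x)) = _
  rw [toGroup, PresentedMonoid.lift_of, psi, PresentedGroup.toGroup.of]

/-- The linear map `ψ(a)` is a signed permutation. -/
lemma psiW_single (a : s.StructureMonoid) (y : X) :
    (s.psiW a : LinearMap.GeneralLinearGroup ℝ (X →₀ ℝ)).val (Finsupp.single y 1) =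
      (-1 : ℝ) ^ s.mult a y • Finsupp.single (s.perm a y) 1 := by
  classical
  induction a using mul_induction generalizing y with
  | one => simp
  | mul x b ih =>
    rw [map_mul, Subgroup.coe_mul, Units.val_mul, Module.End.mul_apply, ih, map_smul,
      psiW_gen_val]
    change _ • s.psiLin x _ = _
    rw [psiLin_single, mult_mul, mult_gen, map_mul, Equiv.Perm.mul_apply, perm_gen]
    split_ifs <;> simp [pow_add]

lemma psiW_eq_of {a b : s.StructureMonoid} (hp : s.perm a = s.perm b)
    (hm : ∀ y, s.mult a y % 2 = s.mult b y % 2) : s.psiW a = s.psiW b := by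
  refine Subtype.ext (Units.ext ?_)
  ext1 y
  ext1
  simp only [LinearMap.comp_apply, Finsupp.lsingle_apply]
  rw [psiW_single, psiW_single, hp, neg_one_pow_eq_pow_mod_two, hm,
    ← neg_one_pow_eq_pow_mod_two]

lemma mult_mod_two_of_psiW_eq {a b : s.StructureMonoid} (h : s.psiW a = s.psiW b) (y : X) :
    s.mult a y % 2 = s.mult b y % 2 := by
  have h1 := psiW_single a y
  rw [h, psiW_single] at h1
  -- The sum of coefficients forgets the basis vector and leaves the sign.
  have h2 := congrArg (fun v => v.sum fun _ c => c) h1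
  simp only [Finsupp.smul_single, Finsupp.sum_single_index, smul_eq_mul, mul_one] at h2
  rcases Nat.even_or_odd (s.mult a y) with ha | ha <;>
    rcases Nat.even_or_odd (s.mult b y) with hb | hb
  · rw [Nat.even_iff.mp ha, Nat.even_iff.mp hb]
  · rw [ha.neg_one_pow, hb.neg_one_pow] at h2; norm_num at h2
  · rw [ha.neg_one_pow, hb.neg_one_pow] at h2; norm_num at h2
  · rw [Nat.odd_iff.mp ha, Nat.odd_iff.mp hb]

/-- The pair `(φ_z(z), z)` is frozen, so Property (C) makes the permutation trivial, and the
multiplicity vector is `2 e_z`, so all signs are positive. -/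
lemma psiW_phi_self_mul (hC : s.PropertyC) (z : X) :
    s.psiW (s.gen (s.phi z z) * s.gen z) = 1 := by
  classical
  rw [← map_one s.psiW]
  refine psiW_eq_of (Equiv.ext fun y => ?_) fun y => ?_
  · have h : s.f z (s.f (s.phi z z) y) = y := congrFun (hC _ _ (isFrozen_phi_self z)).2 y
    rw [map_mul, map_one, perm_gen, perm_gen, Equiv.Perm.mul_apply, Equiv.Perm.one_apply]
    conv_lhs => rw [← h]
    rw [phi_f, phi_f]
  · have := mult_gen_mul (s.gen z) z y
    rw [perm_gen] at this
    rw [this, mult_gen, mult_one]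
    split_ifs <;> rfl

/-- Inverses of generators are images of generators, by `psiW_phi_self_mul`, so positive words
suffice. -/
lemma psiW_surjective (hC : s.PropertyC) : Function.Surjective s.psiW := by
  have hinv (x : X) : ∃ a, s.psiW a = (s.psiW (s.gen x))⁻¹ :=
    ⟨s.gen (s.phi x x), eq_inv_of_mul_eq_one_left (by rw [← map_mul, psiW_phi_self_mul hC])⟩
  rintro ⟨_, γ, rfl⟩
  suffices h : ∃ a, s.psiW a = s.psi.rangeRestrict γ from h
  induction γ using PresentedGroup.induction_on with | _ z
  induction z using FreeGroup.induction_on with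
  | C1 => exact ⟨1, by simp⟩
  | of x => exact ⟨s.gen x, rfl⟩
  | inv_of x _ =>
    obtain ⟨a, ha⟩ := hinv x
    refine ⟨a, ?_⟩
    rw [ha, map_inv, map_inv]
    rfl
  | mul x y hx hy =>
    obtain ⟨a, ha⟩ := hx
    obtain ⟨b, hb⟩ := hy
    exact ⟨a * b, by rw [map_mul, map_mul, map_mul, ha, hb]⟩

/-! ### Parity classes and word length. -/

section Finite

variable [Fintype X]

/-- Each element of `W(X, S)` is the image of a simple element. -/
lemma exists_mult_eq_mod_two (hC : s.PropertyC) (a : s.StructureMonoid) :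
    ∃ r, (∀ y, s.mult r y = s.mult a y % 2) ∧ s.psiW r = s.psiW a := by
  classical
  induction hn : degree a using Nat.strong_induction_on generalizing a with
  | _ n ih =>
    by_cases h : ∃ y, 2 ≤ s.mult a y
    · obtain ⟨y, hy⟩ := h
      obtain ⟨b, hb⟩ := s.mult_surjective fun t => s.mult a t - if t = y then 2 else 0
      -- Both prepended letters raise the multiplicity at `y`, and their product acts trivially: a
      -- factor `2 e_y` splits off.
      have hab : a = (s.gen (s.phi (s.perm b y) (s.perm b y)) * s.gen (s.perm b y)) * b := by
        refine mult_injective (funext fun t => ?_)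
        have := mult_gen_mul (s.gen (s.perm b y) * b) y t
        rw [map_mul, perm_gen, Equiv.Perm.mul_apply] at this
        rw [mul_assoc, this, mult_gen_mul, hb]
        by_cases h : t = y
        · subst h; simp; omega
        · simp [h]
      obtain ⟨r, hr, hr'⟩ := ih (degree b) (by
        rw [← hn, hab]; simp only [degree_mul, degree_gen]; omega) b rfl
      refine ⟨r, fun t => ?_, ?_⟩
      · rw [hr, hb]
        by_cases h : t = y
        · subst h; simp; omega
        · simp [h]
      · rw [hr', hab, map_mul, psiW_phi_self_mul hC, one_mul]
    · push Not at h
      exact ⟨a, fun y => (Nat.mod_eq_of_lt (h y)).symm, rfl⟩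

/-- The permutation carries no extra information: the simple representative of `ψ(a)` is determined
by parities. -/
lemma psiW_eq_iff (hC : s.PropertyC) {a b : s.StructureMonoid} :
    s.psiW a = s.psiW b ↔ ∀ y, s.mult a y % 2 = s.mult b y % 2 := by
  refine ⟨mult_mod_two_of_psiW_eq, fun h => ?_⟩
  obtain ⟨r, hr, hra⟩ := exists_mult_eq_mod_two hC a
  obtain ⟨t, ht, htb⟩ := exists_mult_eq_mod_two hC b
  have hrt : r = t := mult_injective (funext fun y => by rw [hr, ht, h])
  rw [← hra, ← htb, hrt]

lemma exists_word (a : s.StructureMonoid) :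
    ∃ l : List s.W, (∀ w ∈ l, w ∈ s.gens) ∧ l.prod = s.psiW a ∧ l.length = degree a := by
  induction a using mul_induction with
  | one => exact ⟨[], by simp⟩
  | mul x b ih =>
    obtain ⟨l, h1, h2, h3⟩ := ih
    refine ⟨s.psiW (s.gen x) :: l, ?_, ?_, ?_⟩
    · rintro w hw
      rcases List.mem_cons.mp hw with rfl | hw
      · exact ⟨x, rfl⟩
      · exact h1 w hw
    · rw [List.prod_cons, h2, map_mul]
    · rw [List.length_cons, h3, degree_mul, degree_gen, Nat.add_comm]

lemma exists_degree_eq_length (l : List s.W) (hl : ∀ w ∈ l, w ∈ s.gens) :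
    ∃ a, s.psiW a = l.prod ∧ degree a = l.length := by
  induction l with
  | nil => exact ⟨1, by simp⟩
  | cons w l ih =>
    obtain ⟨a, h1, h2⟩ := ih fun v hv => hl v (List.mem_cons_of_mem w hv)
    obtain ⟨x, hx⟩ := hl w List.mem_cons_self
    refine ⟨s.gen x * a, ?_, ?_⟩
    · rw [map_mul, h1, List.prod_cons]
      exact congrArg (· * l.prod) hx
    · rw [degree_mul, degree_gen, h2, List.length_cons, Nat.add_comm]

/-- The simple representative gives a word of this length. Any word lifts to an element with the
same parities, whose degree is at least the number of odd coordinates. -/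
lemma wordLength_psiW (hC : s.PropertyC) (a : s.StructureMonoid) :
    wordLength s.gens (s.psiW a) = ((∑ y, s.mult a y % 2 : ℕ) : ℕ∞) := by
  apply le_antisymm
  · obtain ⟨r, hr, hra⟩ := exists_mult_eq_mod_two hC a
    obtain ⟨l, h1, h2, h3⟩ := exists_word r
    refine (iInf_le _ ⟨l, h1, h2.trans hra⟩).trans (le_of_eq ?_)
    simp only [h3, degree, hr]
  · refine le_iInf fun ⟨l, h1, h2⟩ => ?_
    obtain ⟨b, hb, hd⟩ := exists_degree_eq_length l h1
    rw [← hd]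
    norm_cast
    refine Finset.sum_le_sum fun y _ => ?_
    rw [mult_mod_two_of_psiW_eq (h2.symm.trans hb.symm) y]
    exact Nat.mod_le _ _

end Finite

end SymmSolution

end

/-! ### The main theorem. -/

open SymmSolution in
theorem mainTheorem10 {X : Type*} [Finite X] [Nonempty X] (s : SymmSolution X)
    (hC : s.PropertyC) :
    ∃ Δ : s.StructureMonoid,
      IsTheGarsideElement Δ ∧
      (∀ d : s.StructureMonoid, IsTheGarsideElement d → d = Δ) ∧
      (∀ w : s.W, (∀ v : s.W, wordLength s.gens v ≤ wordLength s.gens w) ↔ w = s.psiW Δ) ∧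
      wordLength s.gens (s.psiW Δ) = (Nat.card X : ℕ∞) ∧
      orderOf (s.psiW Δ) = 2 ∧
      Set.BijOn (fun a : s.W => s.psiW Δ * a * (s.psiW Δ)⁻¹) s.gens s.gens := by
  classical
  cases nonempty_fintype X
  obtain ⟨Δ, hΔ⟩ := s.mult_surjective fun _ => 1
  have hΔ (y : X) : s.mult Δ y = 1 := congrFun hΔ y
  have hlen : wordLength s.gens (s.psiW Δ) = (Nat.card X : ℕ∞) := by
    rw [wordLength_psiW hC]
    simp [hΔ]
  have hsq : s.psiW Δ * s.psiW Δ = 1 := by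
    rw [← map_mul, ← map_one s.psiW, psiW_eq_iff hC]
    intro y
    simp [mult_mul, hΔ]
  have hinv : (s.psiW Δ)⁻¹ = s.psiW Δ := inv_eq_of_mul_eq_one_left hsq
  have hmaps : Set.MapsTo (fun a : s.W => s.psiW Δ * a * (s.psiW Δ)⁻¹) s.gens s.gens := by
    rintro _ ⟨x, rfl⟩
    -- The two factors `Δ` add 2 to every multiplicity, and the inner one shifts `e_x` along `perm
    -- Δ`.
    refine ⟨(s.perm Δ).symm x, ?_⟩
    simp only [hinv, ← map_mul]
    rw [psiW_eq_iff hC]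
    intro y
    simp only [mult_mul, hΔ, mult_gen, Equiv.eq_symm_apply]
    omega
  have hinvol (a : s.W) :
      s.psiW Δ * (s.psiW Δ * a * (s.psiW Δ)⁻¹) * (s.psiW Δ)⁻¹ = a := by
    rw [hinv, mul_assoc (s.psiW Δ) a, ← mul_assoc, hsq, one_mul, mul_assoc, hsq, mul_one]
  refine ⟨Δ, isTheGarsideElement_of_mult_eq_one hΔ, fun d hd =>
    eq_of_isTheGarsideElement hd (isTheGarsideElement_of_mult_eq_one hΔ), fun w => ?_, hlen, ?_,
    hmaps, fun a _ b _ h => ?_, fun a ha => ⟨_, hmaps ha, hinvol a⟩⟩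
  · obtain ⟨a, rfl⟩ := psiW_surjective hC w
    constructor
    · intro h
      have h := h (s.psiW Δ)
      rw [wordLength_psiW hC, wordLength_psiW hC] at h
      norm_cast at h
      have hle (y : X) : s.mult a y % 2 ≤ s.mult Δ y % 2 := by rw [hΔ]; omega
      rw [psiW_eq_iff hC]
      intro y
      -- Termwise inequality with equal sums forces every parity to be 1.
      exact (Finset.sum_eq_sum_iff_of_le fun y _ => hle y).mp
        (le_antisymm (Finset.sum_le_sum fun y _ => hle y) h) y (Finset.mem_univ y)
    · intro h v
      obtain ⟨b, rfl⟩ := psiW_surjective hC v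
      rw [h, wordLength_psiW hC, wordLength_psiW hC]
      norm_cast
      refine Finset.sum_le_sum fun y _ => ?_
      rw [hΔ]
      omega
  · refine orderOf_eq_prime (by rw [pow_two, hsq]) fun h => ?_
    rw [← map_one s.psiW, psiW_eq_iff hC] at h
    obtain ⟨y⟩ := ‹Nonempty X›
    simpa [hΔ] using h y
  · exact mul_left_cancel (mul_right_cancel h)
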